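/- All graphs are finite and simple. For a graph $G$ let $\chi(G)$ be its chromatic number, $\theta(G)$ the minimum number of cliques needed to cover its vertices, $\omega(G)$ its clique number and $\alpha(G)$ its stability number. A graph $G$ is $\chi$-bounded (respectively $\theta$-bounded) by a function $f:\mathbb{N}\to\mathbb{R}$ if $\chi(H)\le f(\omega(H))$ (respectively $\theta(H)\le f(\alpha(H))$) for every induced subgraph $H$ of $G$. A class of graphs is $\chi$-bounded (respectively $\theta$-bounded) if all its members are $\chi$-bounded (respectively $\theta$-bounded) by one common function. A function $f$ is complementary-bounded if the class of all graphs that are $\chi$-bounded by $f$ is $\theta$-bounded. For integers $n,k\ge 0$, the Schrijver graph $SG_{n,k}$ has as vertices the $n$-element subsets of the cyclically ordered set $\{1,\dots,2n+k\}$ that contain no two cyclically neighbouring elements, two distinct vertices being adjacent if and only if they are disjoint. **Theorem 4.8.** Let $j$ be any real number and let $f(x)=x+x/\log^j(x)$, where $\log$ is the natural logarithm, $\log^j(x)=(\log x)^j$, $f(0)=0$ and, if $j>0$, $f(1)=1$. Then $f$ is not complementary-bounded. Moreover, there is a class $\mathcal{S}$ of Schrijver graphs such that every graph in $\mathcal{S}$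 is $\theta$-bounded by $f$, the chromatic numbers of the graphs in $\mathcal{S}$ are unbounded, and $\mathcal{S}$ is not $\chi$-bounded. In terms of complements: every graph in $\overline{\mathcal{S}}=\{\overline{G}:G\in\mathcal{S}\}$ is $\chi$-bounded by $f$, but $\overline{\mathcal{S}}$ is not $\theta$-bounded. -/

import Mathlib

namespace ChiBoundedness

/-- The clique cover number `θ(G)`: the minimum number of cliques needed to cover the vertices. -/
noncomputable def cliqueCoverNum {V : Type*} (G : SimpleGraph V) : ℕ :=
  sInf {m : ℕ | ∃ c : Fin m → Set V, (∀ i, G.IsClique (c i)) ∧ ⋃ i, c i = Set.univ}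

/-- A finite graph `G` is `χ`-bounded by `f` if `χ(H) ≤ f(ω(H))` for every induced subgraph `H`.
(The chromatic number of a finite graph is finite, so `toNat` only changes its type.) -/
def ChiBoundedBy {V : Type*} [Finite V] (G : SimpleGraph V) (f : ℕ → ℝ) : Prop :=
  ∀ s : Set V, ((G.induce s).chromaticNumber.toNat : ℝ) ≤ f (G.induce s).cliqueNum

/-- A finite graph `G` is `θ`-bounded by `f` if `θ(H) ≤ f(α(H))` for every induced subgraph `H`. -/
def ThetaBoundedBy {V : Type*} [Finite V] (G : SimpleGraph V) (f : ℕ → ℝ) : Prop :=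
  ∀ s : Set V, (cliqueCoverNum (G.induce s) : ℝ) ≤ f (G.induce s).indepNum

/-- `f` is complementary-bounded if the class of all finite graphs that are `χ`-bounded by `f`
is `θ`-bounded, that is, `θ`-bounded by one function `g`. -/
def ComplementaryBounded (f : ℕ → ℝ) : Prop :=
  ∃ g : ℕ → ℝ, ∀ (V : Type) [Finite V] (G : SimpleGraph V),
    ChiBoundedBy G f → ThetaBoundedBy G g

/-- The vertices of the Schrijver graph `SG_{n,k}`: the `n`-element subsets of a cyclically ordered
set of `2n+k` elements that contain no two cyclically neighbouring elements. -/
abbrev SchrijverVertex (n k : ℕ) : Type :=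
  {S : Finset (Fin (2 * n + k)) //
    S.card = n ∧ (SimpleGraph.cycleGraph (2 * n + k)).IsIndepSet (S : Set (Fin (2 * n + k)))}

/-- The Schrijver graph `SG_{n,k}`: two distinct vertices are adjacent iff they are disjoint
(the condition `S ≠ T` is automatic for `n ≥ 1`). -/
def schrijverGraph (n k : ℕ) : SimpleGraph (SchrijverVertex n k) where
  Adj S T := S ≠ T ∧ Disjoint S.1 T.1
  symm := ⟨fun _ _ h => ⟨h.1.symm, h.2.symm⟩⟩
  loopless := ⟨fun _ h => h.1 rfl⟩

/-- The function `x ↦ x + x / (log x)^j` on the natural numbers. The values that matter are those at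
`x ≥ 2`: at `x = 0` it is `0`, and at `x = 1` it is `1` for `j ≠ 0` (for `j > 0` through the
convention `1 / 0 = 0`) and `2` for `j = 0`. Any value at least `1` there would give the same notion
of boundedness, because `χ(H) = 1` when `ω(H) = 1`, and `θ(H) = 1` when `α(H) = 1`. -/
noncomputable def polylogFun (j : ℝ) (x : ℕ) : ℝ :=
  (x : ℝ) + (x : ℝ) / (Real.log (x : ℝ)) ^ j

end ChiBoundedness

open ChiBoundedness

/-! Fix k and let n grow. The Schrijver graph needs more than k colours, yet for k < n it has no
triangle, so these graphs are not χ-bounded. On the θ side they are almost perfect. In an induced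
subgraph H the vertices containing a given point are independent, and each vertex contains n of the
2n+k points, so α(H) ≥ n|H|/(2n+k). A vertex misses both p and p+1 for exactly k positions p, so
some p is such that at most k|H|/(2n+k) ≤ (k/n)α(H) vertices miss both. The others form a bipartite
graph, and Kőnig's theorem gives θ(H) ≤ (1+k/n)α(H) (`mul_cliqueCoverNum_induce_schrijverGraph_le`).
For fixed k the number of vertices is polynomial in n (`card_schrijverVertex_le`), so k(log α)^j ≤ n
once n is large and α ≥ 2. Complementation does the rest.

The colour bound `lt_of_schrijverGraph_colorable` rests on Tucker's lemma `le_of_forall_ne_neg`. Its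
proof uses cochains mod 2: the indicator p of the chains whose sorted labels alternate in sign
satisfies δp = p + p∘(−1). By induction on the dimension, p is then 1 on the fundamental cycle of
each sphere, so some maximal chain carries labels of distinct absolute values. -/

namespace ChiBoundedness

/-! ### Simplicial cochains mod 2, prisms and cones -/

section Cochains

variable {V W : Type*}

/-- The simplicial coboundary, modulo 2, of a function on ordered simplices. -/
def coboundary : (List V → ZMod 2) → List V → ZMod 2
  | _, [] => 0
  | p, X :: l => p l + coboundary (fun m => p (X :: m)) l

theorem coboundary_add (p q : List V → ZMod 2) (l : List V) :
    coboundary (fun m => p m + q m) l = coboundary p l + coboundary q l := by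
  induction l generalizing p q with
  | nil => simp [coboundary]
  | cons X l ih => simp only [coboundary, ih]; ring

theorem coboundary_map (f : V → W) (p : List W → ZMod 2) (l : List V) :
    coboundary p (l.map f) = coboundary (fun m => p (m.map f)) l := by
  induction l generalizing p with
  | nil => simp [coboundary]
  | cons X l ih => simp only [coboundary, List.map_cons, ih]

theorem coboundary_perm {p : List V → ZMod 2} (hp : ∀ l m, l.Perm m → p l = p m)
    {l m : List V} (h : l.Perm m) : coboundary p l = coboundary p m := by
  induction h generalizing p with
  | nil => rfl
  | cons X h ih =>
    simp only [coboundary, hp _ _ h, ih fun a b hab => hp _ _ (hab.cons X)]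
  | swap X Y l =>
    simp only [coboundary]
    have : (fun m => p (X :: Y :: m)) = fun m => p (Y :: X :: m) :=
      funext fun m => hp _ _ (List.Perm.swap _ _ _)
    rw [this]; ring
  | trans _ _ ih₁ ih₂ => rw [ih₁ hp, ih₂ hp]

theorem coboundary_congr_of_sublist {p q : List V → ZMod 2} {l : List V}
    (h : ∀ m, m.Sublist l → p m = q m) : coboundary p l = coboundary q l := by
  induction l generalizing p q with
  | nil => rfl
  | cons X l ih =>
    simp only [coboundary, h l (List.sublist_cons_self X l),
      ih fun m hm => h (X :: m) (hm.cons_cons X)]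

/-- The pullback of a cochain along the prism operator from the identity to `φ`. -/
def prism (φ : V → V) : (List V → ZMod 2) → List V → ZMod 2
  | _, [] => 0
  | p, X :: l => p (X :: φ X :: l.map φ) + prism φ (fun m => p (X :: m)) l

theorem prism_add (φ : V → V) (p q : List V → ZMod 2) (l : List V) :
    prism φ (fun m => p m + q m) l = prism φ p l + prism φ q l := by
  induction l generalizing p q with
  | nil => simp [prism]
  | cons X l ih => simp only [prism, ih]; ring

/-- The boundary of a prism is its top, its bottom and the prism over the boundary: the usual chain
homotopy between the identity and `φ`. -/
theorem prism_coboundary (φ : V → V) (p : List V → ZMod 2) (l : List V) :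
    prism φ (coboundary p) l = p (l.map φ) + p l + coboundary (prism φ p) l := by
  induction l generalizing p with
  | nil => simp [prism, coboundary, CharTwo.add_self_eq_zero]
  | cons X l ih =>
    simp only [prism, coboundary, prism_add, coboundary_add, ih, List.map_cons, coboundary_map]
    linear_combination CharTwo.add_self_eq_zero (p (X :: l.map φ))

theorem prism_eq_zero (φ : V → V) (p : List V → ZMod 2) (l : List V)
    (h : ∀ l₁ X l₂, l = l₁ ++ X :: l₂ → p (l₁ ++ X :: φ X :: l₂.map φ) = 0) :
    prism φ p l = 0 := by
  induction l generalizing p with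
  | nil => rfl
  | cons X l ih =>
    rw [prism, ih, add_zero]
    · exact h [] X l rfl
    · rintro l₁ Y l₂ rfl
      exact h (X :: l₁) Y l₂ rfl

/-- The pullback of a cochain along the contraction that moves by `φ` and then cones to `e`. -/
def contraction (φ : V → V) (e : V) (p : List V → ZMod 2) (l : List V) : ZMod 2 :=
  prism φ p l + p (e :: l.map φ)

theorem contraction_add (φ : V → V) (e : V) (p q : List V → ZMod 2) (l : List V) :
    contraction φ e (fun m => p m + q m) l = contraction φ e p l + contraction φ e q l := by
  simp only [contraction, prism_add]; ring

/-- The base of the cone cancels the `φ` end of the prism, so the contraction is a homotopy from the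
identity to zero. -/
theorem contraction_coboundary (φ : V → V) (e : V) (p : List V → ZMod 2) (l : List V) :
    contraction φ e (coboundary p) l = p l + coboundary (contraction φ e p) l := by
  have : contraction φ e p = fun m => prism φ p m + p (e :: m.map φ) := rfl
  rw [this, coboundary_add, contraction, prism_coboundary, coboundary, coboundary_map]
  linear_combination CharTwo.add_self_eq_zero (p (l.map φ))

end Cochains

/-! ### The sphere of sign vectors and Tucker's lemma -/

section SignVectors

/-- `Y` extends the sign vector `X`: it agrees with `X` on the support of `X`. -/
def SignLE (X Y : ℕ → SignType) : Prop := ∀ i, X i ≠ 0 → Y i = X i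

/-- A chain of `n` nonzero sign vectors supported in the first `n` coordinates. -/
def IsSignChain (n : ℕ) (l : List (ℕ → SignType)) : Prop :=
  l.length = n ∧ l.Pairwise SignLE ∧ ∀ X ∈ l, X ≠ 0 ∧ ∀ i, n ≤ i → X i = 0

/-- Coordinate `n` vanishes on the whole chain, so setting it to 1 only extends the vectors. -/
theorem IsSignChain.prism {n : ℕ} {l₁ l₂ : List (ℕ → SignType)} {X : ℕ → SignType}
    (h : IsSignChain n (l₁ ++ X :: l₂)) :
    IsSignChain (n + 1) (l₁ ++ X :: Function.update X n 1 ::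
      l₂.map (fun Y => Function.update Y n 1)) := by
  obtain ⟨h₁, h₂, h₃⟩ := h
  have key : ∀ X Y : ℕ → SignType, SignLE X Y → SignLE (Function.update X n 1)
      (Function.update Y n 1) := by
    intro X Y h i hi
    by_cases hin : i = n
    · subst hin; simp
    · simp only [Function.update_of_ne hin] at hi ⊢; exact h i hi
  have key' : ∀ X Y : ℕ → SignType, X n = 0 → SignLE X Y → SignLE X (Function.update Y n 1) := by
    intro X Y h0 h i hi
    by_cases hin : i = n
    · subst hin; exact absurd h0 hi
    · simp only [Function.update_of_ne hin]; exact h i hi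
  have ne : ∀ X : ℕ → SignType, Function.update X n 1 ≠ 0 := by
    intro X h
    have := congrFun h n
    simp at this
  have refl : SignLE X X := fun _ _ => rfl
  have hs : ∀ X : ℕ → SignType, (∀ i, n ≤ i → X i = 0) →
      ∀ i, n + 1 ≤ i → Function.update X n 1 i = 0 := by
    intro X h i hi
    rw [Function.update_of_ne (by omega)]; exact h i (by omega)
  refine ⟨by simp at h₁ ⊢; omega, ?_, ?_⟩
  · simp only [List.pairwise_append, List.pairwise_cons, List.mem_cons, List.mem_map,
      List.pairwise_map] at h₂ ⊢
    obtain ⟨h₂, ⟨h₄, h₅⟩, h₆⟩ := h₂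
    have hX := (h₃ X (by simp)).2 n le_rfl
    refine ⟨h₂, ⟨?_, ?_, h₅.imp (key _ _)⟩, ?_⟩
    · rintro Y (rfl | ⟨Z, hZ, rfl⟩)
      · exact key' _ _ hX refl
      · exact key' _ _ hX (h₄ Z hZ)
    · rintro Y ⟨Z, hZ, rfl⟩
      exact key _ _ (h₄ Z hZ)
    · intro Y hY
      have hY0 := (h₃ Y (by simp [hY])).2 n le_rfl
      rintro Z (rfl | rfl | ⟨Z, hZ, rfl⟩)
      · exact h₆ Y hY _ (Or.inl rfl)
      · exact key' _ _ hY0 (h₆ Y hY _ (Or.inl rfl))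
      · exact key' _ _ hY0 (h₆ Y hY _ (Or.inr hZ))
  · intro Y hY
    simp only [List.mem_append, List.mem_cons, List.mem_map] at hY
    rcases hY with hY | rfl | rfl | ⟨Z, hZ, rfl⟩
    · have := h₃ Y (by simp [hY]); exact ⟨this.1, fun i hi => this.2 i (by omega)⟩
    · have := h₃ Y (by simp); exact ⟨this.1, fun i hi => this.2 i (by omega)⟩
    · exact ⟨ne _, hs _ (h₃ X (by simp)).2⟩
    · exact ⟨ne _, hs _ (h₃ Z (by simp [hZ])).2⟩

theorem IsSignChain.cone {n : ℕ} {l : List (ℕ → SignType)} (h : IsSignChain n l) :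
    IsSignChain (n + 1) (Function.update 0 n 1 :: l.map (fun Y => Function.update Y n 1)) := by
  obtain ⟨h₁, h₂, h₃⟩ := h
  have ne : ∀ X : ℕ → SignType, Function.update X n 1 ≠ 0 := by
    intro X h
    have := congrFun h n
    simp at this
  refine ⟨by simp [h₁], ?_, ?_⟩
  · simp only [List.pairwise_cons, List.mem_map, List.pairwise_map]
    refine ⟨?_, h₂.imp ?_⟩
    · rintro Y ⟨Z, hZ, rfl⟩ i hi
      by_cases hin : i = n
      · subst hin; simp
      · simp [Function.update_of_ne hin] at hi
    · intro X Y h i hi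
      by_cases hin : i = n
      · subst hin; simp
      · simp only [Function.update_of_ne hin] at hi ⊢; exact h i hi
  · intro Y hY
    simp only [List.mem_cons, List.mem_map] at hY
    rcases hY with rfl | ⟨Z, hZ, rfl⟩
    · exact ⟨ne _, fun i hi => by rw [Function.update_of_ne (by omega)]; rfl⟩
    · exact ⟨ne _, fun i hi => by
        rw [Function.update_of_ne (by omega)]; exact (h₃ Z hZ).2 i (by omega)⟩

theorem IsSignChain.neg {n : ℕ} {l : List (ℕ → SignType)} (h : IsSignChain n l) :
    IsSignChain n (l.map Neg.neg) := by
  obtain ⟨h₁, h₂, h₃⟩ := h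
  refine ⟨by simp [h₁], ?_, ?_⟩
  · rw [List.pairwise_map]
    exact h₂.imp fun {X Y} h i hi => by
      have : X i ≠ 0 := fun h0 => hi (by simp [h0])
      simp [h i this]
  · intro Y hY
    obtain ⟨Z, hZ, rfl⟩ := List.mem_map.1 hY
    refine ⟨fun h0 => (h₃ Z hZ).1 ?_, fun i hi => by simp [(h₃ Z hZ).2 i hi]⟩
    funext i
    have := congrFun h0 i
    simpa using this

/-- Evaluation of cochains at the fundamental cycle of the sphere of sign vectors supported in the
first `n` coordinates. Each sphere is the sum of two antipodal hemispheres, each of which is a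
contraction of the preceding sphere. -/
def sphereEval : ℕ → (List (ℕ → SignType) → ZMod 2) → ZMod 2
  | 0, p => p []
  | n + 1, p =>
    sphereEval n (contraction (fun X => Function.update X n 1) (Function.update 0 n 1) p) +
    sphereEval n (contraction (fun X => Function.update X n 1) (Function.update 0 n 1)
      fun l => p (l.map Neg.neg))

theorem sphereEval_add (n : ℕ) (p q : List (ℕ → SignType) → ZMod 2) :
    sphereEval n (fun l => p l + q l) = sphereEval n p + sphereEval n q := by
  induction n generalizing p q with
  | zero => rfl
  | succ n ih =>
    simp only [sphereEval]
    have h := fun p q : List (ℕ → SignType) → ZMod 2 => funext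
      (contraction_add (fun X => Function.update X n 1) (Function.update 0 n 1) p q)
    rw [h, h, ih, ih]; ring

theorem sphereEval_eq_zero {n : ℕ} {p : List (ℕ → SignType) → ZMod 2}
    (h : ∀ l, IsSignChain n l → p l = 0) : sphereEval n p = 0 := by
  induction n generalizing p with
  | zero => exact h [] ⟨rfl, List.Pairwise.nil, by simp⟩
  | succ n ih =>
    have key : ∀ q : List (ℕ → SignType) → ZMod 2, (∀ l, IsSignChain (n + 1) l → q l = 0) →
        ∀ l, IsSignChain n l → contraction (fun X => Function.update X n 1)
          (Function.update 0 n 1) q l = 0 := by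
      intro q hq l hl
      rw [contraction, prism_eq_zero, hq _ hl.cone, add_zero]
      rintro l₁ X l₂ rfl
      exact hq _ hl.prism
    rw [sphereEval, ih (key _ h), ih (key _ fun l hl => h _ hl.neg), add_zero]

theorem sphereEval_neg (n : ℕ) (p : List (ℕ → SignType) → ZMod 2) :
    sphereEval n (fun l => p (l.map Neg.neg)) = sphereEval n p := by
  cases n with
  | zero => rfl
  | succ n =>
    simp only [sphereEval, List.map_map]
    have : (Neg.neg ∘ Neg.neg : (ℕ → SignType) → (ℕ → SignType)) = id := by
      funext X; simp
    simp only [this, List.map_id]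
    rw [add_comm]

/-- Stokes on a hemisphere, whose boundary is the preceding sphere; `ih` says that this sphere is a
cycle. -/
theorem sphereEval_coboundary_succ (n : ℕ) (p : List (ℕ → SignType) → ZMod 2)
    (ih : ∀ q, sphereEval n (coboundary q) = 0) :
    sphereEval n (contraction (fun X => Function.update X n 1) (Function.update 0 n 1)
      (coboundary p)) = sphereEval n p := by
  rw [funext (contraction_coboundary _ _ p), sphereEval_add, ih, add_zero]

theorem sphereEval_coboundary (n : ℕ) (p : List (ℕ → SignType) → ZMod 2) :
    sphereEval n (coboundary p) = 0 := by
  induction n generalizing p with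
  | zero => rfl
  | succ n ih =>
    rw [sphereEval, sphereEval_coboundary_succ n p ih]
    simp only [coboundary_map]
    rw [sphereEval_coboundary_succ n _ ih, sphereEval_neg, CharTwo.add_self_eq_zero]

/-- Write the sphere as D + (−D) for a hemisphere D. Then p(D) + p(−D) = δp(D) = p(∂D), which is the
value on the sphere one dimension lower. -/
theorem sphereEval_eq_one {n : ℕ} {p : List (ℕ → SignType) → ZMod 2} (h0 : p [] = 1)
    (h : ∀ k ≤ n, ∀ l, IsSignChain k l → coboundary p l = p l + p (l.map Neg.neg)) :
    sphereEval n p = 1 := by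
  induction n with
  | zero => exact h0
  | succ n ih =>
    replace ih := ih fun k hk => h k (hk.trans n.le_succ)
    set K := contraction (fun X : ℕ → SignType => Function.update X n 1) (Function.update 0 n 1)
      with hK
    have hz : ∀ l, IsSignChain n l →
        K (fun l => coboundary p l + (p l + p (l.map Neg.neg))) l = 0 := by
      intro l hl
      have hq : ∀ l, IsSignChain (n + 1) l →
          coboundary p l + (p l + p (l.map Neg.neg)) = 0 := fun l hl => by
        rw [h _ le_rfl l hl, CharTwo.add_self_eq_zero]
      rw [hK, contraction, prism_eq_zero, hq _ hl.cone, add_zero]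
      rintro l₁ X l₂ rfl
      exact hq _ hl.prism
    have e := sphereEval_eq_zero hz
    rw [hK, funext (contraction_add _ _ (coboundary p) _), sphereEval_add,
      sphereEval_coboundary_succ n p (sphereEval_coboundary n), ih,
      funext (contraction_add _ _ p _), sphereEval_add] at e
    rw [sphereEval]
    exact (CharTwo.add_eq_zero.1 e).symm

/-- The indicator, modulo 2, of the words that alternate starting from `b`. -/
def alternates : Bool → List Bool → ZMod 2
  | _, [] => 1
  | b, x :: l => if x = b then alternates (!b) l else 0

/-- If `w` alternates from `b`, only deleting its last letter keeps it so; if it alternates from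
`!b`, only deleting the first letter works. Otherwise two adjacent letters agree, and deleting
either one gives the same word, so the contributions cancel. -/
theorem coboundary_alternates (b : Bool) (w : List Bool) :
    coboundary (alternates b) w = alternates b w + alternates (!b) w := by
  induction w generalizing b with
  | nil => simp [coboundary, alternates, CharTwo.add_self_eq_zero]
  | cons x l ih =>
    have hz : ∀ l : List Bool, coboundary (fun _ => (0 : ZMod 2)) l = 0 := by
      intro l; induction l with
      | nil => rfl
      | cons x l ih => simp [coboundary, ih]
    by_cases hx : x = b
    · subst hx
      simp only [coboundary, alternates, if_true, ih]
      have : ¬ x = !x := by cases x <;> simp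
      simp only [this, if_false, Bool.not_not]
      linear_combination CharTwo.add_self_eq_zero (alternates x l)
    · have hx' : x = !b := by cases x <;> cases b <;> simp_all
      simp only [coboundary, alternates, hx, if_false, hz]
      simp [hx']

theorem alternates_map_not (b : Bool) (w : List Bool) :
    alternates b (w.map not) = alternates (!b) w := by
  induction w generalizing b with
  | nil => rfl
  | cons x l ih =>
    simp only [List.map_cons, alternates, ih]
    cases x <;> cases b <;> simp

theorem pairwise_lt_of_alternates (b : Bool) (l : List (ℕ ×ₗ Bool))
    (hl : l.Pairwise (· ≤ ·))
    (hc : ∀ x ∈ l, ∀ y ∈ l, (ofLex x).1 = (ofLex y).1 → x = y)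
    (h : alternates b (l.map fun x => (ofLex x).2) ≠ 0) :
    (l.map fun x => (ofLex x).1).Pairwise (· < ·) := by
  rw [← List.isChain_iff_pairwise]
  induction l generalizing b with
  | nil => simp
  | cons x l ih =>
    cases l with
    | nil => simp
    | cons y l =>
      simp only [List.map_cons, alternates] at h
      by_cases hx : (ofLex x).2 = b
      · rw [if_pos hx] at h
        have ih' := ih (!b) (List.pairwise_cons.1 hl).2
          (fun u hu v hv => hc u (List.mem_cons_of_mem _ hu) v (List.mem_cons_of_mem _ hv))
          (by simpa only [List.map_cons, alternates] using h)
        simp only [List.map_cons, List.isChain_cons_cons] at ih' ⊢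
        refine ⟨?_, ih'⟩
        have hy : (ofLex y).2 = !b := by
          by_contra hy; simp [hy] at h
        have hxy := (List.pairwise_cons.1 hl).1 y (by simp)
        rcases (Prod.Lex.le_iff.1 hxy) with h1 | h1
        · exact h1
        · have := hc x (by simp) y (by simp) h1.1
          rw [this, hy] at hx
          cases b <;> simp at hx
      · rw [if_neg hx] at h; exact absurd rfl h

/-- **Tucker's lemma** for the octahedral triangulation of the sphere. -/
theorem le_of_forall_ne_neg {N M : ℕ} (F : (ℕ → SignType) → ℕ)
    (mono : ∀ X Y, SignLE X Y → F X ≤ F Y) (le : ∀ X, F X ≤ M)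
    (ne : ∀ X, X ≠ 0 → (∀ i, N ≤ i → X i = 0) → F X ≠ F (-X)) : N ≤ M := by
  -- Tucker's signed label: absolute value max(F X, F(−X)), with sign telling which of the two is
  -- larger.
  let label : (ℕ → SignType) → ℕ ×ₗ Bool := fun X =>
    toLex (max (F X) (F (-X)), decide (F (-X) < F X))
  let flip : ℕ ×ₗ Bool → ℕ ×ₗ Bool := fun x => toLex ((ofLex x).1, !(ofLex x).2)
  let sgn : ℕ ×ₗ Bool → Bool := fun x => (ofLex x).2
  let q : List (ℕ ×ₗ Bool) → ZMod 2 := fun l =>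
    alternates true ((l.insertionSort (· ≤ ·)).map sgn)
  let p : List (ℕ → SignType) → ZMod 2 := fun l => q (l.map label)
  have monoNeg : ∀ X Y, SignLE X Y → F (-X) ≤ F (-Y) := fun X Y h => mono _ _ fun i hi => by
    have : X i ≠ 0 := fun h0 => hi (by simp [h0])
    simp [h i this]
  have hflip : ∀ X, X ≠ 0 → (∀ i, N ≤ i → X i = 0) → label (-X) = flip (label X) := by
    intro X hX hX'
    have := ne X hX hX'
    simp only [label, flip, neg_neg, ofLex_toLex, max_comm (F (-X))]
    congr 2
    by_cases h : F X < F (-X)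
    · simp [h, h.le]
    · have : F (-X) < F X := by omega
      simp [h, this]
  -- No complementary edge: by monotonicity, whichever of F X, F(−X) attains the common maximum
  -- attains it at Y too.
  have hcomp : ∀ X Y, F X ≠ F (-X) → F Y ≠ F (-Y) → SignLE X Y →
      (ofLex (label X)).1 = (ofLex (label Y)).1 → label X = label Y := by
    intro X Y h3 h4 h he
    have h1 := mono X Y h
    have h2 := monoNeg X Y h
    simp only [label, ofLex_toLex] at he ⊢
    rw [he]
    congr 2
    rw [decide_eq_decide]
    omega
  have hgood : ∀ k ≤ N, ∀ l, IsSignChain k l → ∀ x ∈ l.map label, ∀ y ∈ l.map label,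
      (ofLex x).1 = (ofLex y).1 → x = y := by
    rintro k hk l ⟨-, h₂, h₃⟩
    have h₄ : ∀ X ∈ l, F X ≠ F (-X) := fun X hX =>
      ne X (h₃ X hX).1 fun i hi => (h₃ X hX).2 i (hk.trans hi)
    have hsym : (l.map label).Pairwise fun x y => (ofLex x).1 = (ofLex y).1 → x = y := by
      rw [List.pairwise_map]
      exact h₂.imp_of_mem fun ha hb h => hcomp _ _ (h₄ _ ha) (h₄ _ hb) h
    intro x hx y hy
    by_cases hxy : x = y
    · exact fun _ => hxy
    · have : Std.Symm fun x y : ℕ ×ₗ Bool => (ofLex x).1 = (ofLex y).1 → x = y :=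
        ⟨fun _ _ h e => (h e.symm).symm⟩
      exact hsym.forall_of_forall (fun _ _ _ => rfl) hx hy
  have qperm : ∀ l m, l.Perm m → q l = q m := by
    intro l m h
    have : l.insertionSort (· ≤ ·) = m.insertionSort (· ≤ ·) :=
      List.Perm.eq_of_pairwise' (r := (· ≤ ·)) (List.pairwise_insertionSort _ _)
        (List.pairwise_insertionSort _ _)
        ((List.perm_insertionSort _ l).trans (h.trans (List.perm_insertionSort _ m).symm))
    simp only [q, this]
  have qcob : ∀ l, coboundary q l =
      alternates true ((l.insertionSort (· ≤ ·)).map sgn) +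
      alternates false ((l.insertionSort (· ≤ ·)).map sgn) := by
    intro l
    rw [← coboundary_perm qperm (List.perm_insertionSort (· ≤ ·) l)]
    rw [coboundary_congr_of_sublist (q := fun m => alternates true (m.map sgn)),
      ← coboundary_map, coboundary_alternates]
    · rfl
    · intro m hm
      have : m.Pairwise (· ≤ ·) := (List.pairwise_insertionSort (· ≤ ·) l).sublist hm
      simp only [q, this.insertionSort_eq]
  have hp : ∀ k ≤ N, ∀ l, IsSignChain k l → coboundary p l = p l + p (l.map Neg.neg) := by
    intro k hk l hl
    rw [show coboundary p l = coboundary q (l.map label) from (coboundary_map label q l).symm, qcob]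
    congr 1
    have h1 : (l.map Neg.neg).map label = (l.map label).map flip := by
      rw [List.map_map, List.map_map]
      exact List.map_congr_left fun X hX => hflip X (hl.2.2 X hX).1 fun i hi => (hl.2.2 X hX).2 i (hk.trans hi)
    simp only [p, q, h1]
    -- Sorting commutes with `flip`, because labels of equal absolute value in a chain coincide.
    rw [← List.map_insertionSort (· ≤ ·) (· ≤ ·) flip]
    · have : (List.map sgn (List.map flip ((l.map label).insertionSort (· ≤ ·)))) =
        (((l.map label).insertionSort (· ≤ ·)).map sgn).map not := by
        simp only [List.map_map]; rfl
      rw [this, alternates_map_not]; rfl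
    · intro a ha b hb
      have h2 := hgood k hk l hl a ha b hb
      by_cases hab : a = b
      · subst hab; simp
      · have h3 : (ofLex a).1 ≠ (ofLex b).1 := fun h => hab (h2 h)
        simp [Prod.Lex.le_iff, flip, h3]
  have one := sphereEval_eq_one (n := N) (p := p) rfl hp
  obtain ⟨l, hl, hpl⟩ : ∃ l, IsSignChain N l ∧ p l ≠ 0 := by
    by_contra! h
    rw [sphereEval_eq_zero h] at one
    exact zero_ne_one one
  set s := (l.map label).insertionSort (· ≤ ·) with hs
  have hmem : ∀ x, x ∈ s ↔ x ∈ l.map label := fun x => List.mem_insertionSort _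
  have hlt := pairwise_lt_of_alternates true s (List.pairwise_insertionSort _ _)
    (fun x hx y hy => hgood N le_rfl l hl x ((hmem x).1 hx) y ((hmem y).1 hy)) hpl
  have hnd : (s.map fun x => (ofLex x).1).Nodup := hlt.imp fun h => h.ne
  have hcard := List.toFinset_card_of_nodup hnd
  -- The absolute values are at least 1 because F X and F(−X) differ.
  have hsub : (s.map fun x => (ofLex x).1).toFinset ⊆ Finset.Icc 1 M := by
    intro v hv
    simp only [List.mem_toFinset, List.mem_map, hmem] at hv
    obtain ⟨_, ⟨X, hX, rfl⟩, rfl⟩ := hv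
    have h1 := ne X (hl.2.2 X hX).1 (hl.2.2 X hX).2
    have h2 := le X
    have h3 := le (-X)
    simp only [label, ofLex_toLex, Finset.mem_Icc]
    omega
  have := Finset.card_le_card hsub
  rw [hcard, List.length_map, hs, List.length_insertionSort, List.length_map, hl.1,
    Nat.card_Icc] at this
  omega

end SignVectors


/-! ### The chromatic number of Schrijver graphs -/

theorem not_cycleGraph_adj_of_lt {N : ℕ} {u v : Fin N} (h₁ : (u : ℕ) + 1 < v) (h₂ : (v : ℕ) + 1 < N) :
    ¬ (SimpleGraph.cycleGraph N).Adj u v := by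
  rw [SimpleGraph.cycleGraph_adj']
  have huv : u < v := Fin.lt_def.2 (by omega)
  have e₁ := Fin.sub_val_of_le huv.le
  have e₂ := Fin.coe_sub_iff_lt.2 huv
  omega

/-- Along an increasing sequence of `a` coordinates below `N`, the sign vector `X` alternates,
starting with `1`. -/
def HasAlternation (N a : ℕ) (X : ℕ → SignType) : Prop :=
  ∃ x : ℕ → ℕ, (∀ i j, i < j → j < a → x i < x j) ∧ ∀ i < a, x i < N ∧ X (x i) = (-1) ^ i

theorem HasAlternation.mono {N a : ℕ} {X Y : ℕ → SignType} (h : HasAlternation N a X)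
    (hXY : SignLE X Y) : HasAlternation N a Y := by
  obtain ⟨x, h₁, h₂⟩ := h
  refine ⟨x, h₁, fun i hi => ⟨(h₂ i hi).1, ?_⟩⟩
  rw [hXY _ (by rw [(h₂ i hi).2]; exact pow_ne_zero _ (by decide)), (h₂ i hi).2]

theorem hasAlternation_cons {N a : ℕ} {X : ℕ → SignType} {y : ℕ → ℕ} {z : ℕ} (hz : z < y 0)
    (hzN : z < N) (hXz : X z = 1) (h₁ : ∀ i j, i < j → j < a → y i < y j)
    (h₂ : ∀ i < a, y i < N ∧ (-X) (y i) = (-1) ^ i) : HasAlternation N (a + 1) X := by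
  refine ⟨fun i => Nat.casesOn i z y, ?_, ?_⟩
  · intro i j hij hj
    cases j with
    | zero => omega
    | succ j =>
      cases i with
      | zero =>
        rcases Nat.eq_zero_or_pos j with rfl | h
        · exact hz
        · exact hz.trans (h₁ 0 j h (by omega))
      | succ i => exact h₁ i j (by omega) (by omega)
  · intro i hi
    cases i with
    | zero => exact ⟨hzN, by simpa using hXz⟩
    | succ i =>
      refine ⟨(h₂ i (by omega)).1, ?_⟩
      have := (h₂ i (by omega)).2
      simp only [Pi.neg_apply] at this
      simp only [pow_succ, ← this, mul_neg, mul_one, neg_neg]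

/-- Take the `n` positive terms of the alternation. A negative term separates consecutive ones, and
another follows the last, which also rules out adjacency across the end of the cycle. -/
theorem HasAlternation.exists_schrijverVertex {n k : ℕ} {X : ℕ → SignType}
    (h : HasAlternation (2 * n + k) (2 * n) X) :
    ∃ S : SchrijverVertex n k, ∀ i ∈ S.1, X (i : ℕ) = 1 := by
  obtain ⟨x, h₁, h₂⟩ := h
  let f : Fin n → Fin (2 * n + k) := fun i => ⟨x (2 * i), (h₂ _ (by omega)).1⟩
  have hlt : ∀ i j : Fin n, i < j → (f i : ℕ) + 1 < f j ∧ (f j : ℕ) + 1 < 2 * n + k := by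
    intro i j hij
    have a := h₁ (2 * i) (2 * i + 1) (by omega) (by omega)
    have b := h₁ (2 * i + 1) (2 * j) (by omega) (by omega)
    have c := h₁ (2 * j) (2 * j + 1) (by omega) (by omega)
    have d := (h₂ (2 * j + 1) (by omega)).1
    simp only [f]
    omega
  have hf : Function.Injective f := by
    intro i j hij
    rcases lt_trichotomy i j with h | h | h
    · have := (hlt i j h).1; rw [hij] at this; omega
    · exact h
    · have := (hlt j i h).1; rw [hij] at this; omega
  refine ⟨⟨Finset.univ.image f, ?_, ?_⟩, ?_⟩
  · rw [Finset.card_image_of_injective _ hf, Finset.card_univ, Fintype.card_fin]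
  · intro u hu v hv _
    simp only [Finset.coe_image, Finset.coe_univ, Set.image_univ, Set.mem_range] at hu hv
    obtain ⟨i, rfl⟩ := hu
    obtain ⟨j, rfl⟩ := hv
    rcases lt_trichotomy i j with h | rfl | h
    · exact not_cycleGraph_adj_of_lt (hlt i j h).1 (hlt i j h).2
    · exact SimpleGraph.irrefl _
    · exact fun h' => not_cycleGraph_adj_of_lt (hlt j i h).1 (hlt j i h).2 h'.symm
  · intro i hi
    obtain ⟨j, -, rfl⟩ := Finset.mem_image.1 hi
    have := (h₂ (2 * j) (by omega)).2
    rw [this, pow_mul]; simp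

/-- A lower bound for the chromatic number of Schrijver graphs. -/
theorem lt_of_schrijverGraph_colorable {n k m : ℕ} (hn : 1 ≤ n)
    (h : (schrijverGraph n k).Colorable m) : k < m := by
  classical
  obtain ⟨C⟩ := h
  -- Values below 2n record the length of an alternation, values from 2n on the colour of a vertex
  -- inside the positive part of X.
  let R : (ℕ → SignType) → ℕ → Prop := fun X v =>
    (v < 2 * n ∧ HasAlternation (2 * n + k) v X) ∨
      ∃ S : SchrijverVertex n k, (∀ i ∈ S.1, X (i : ℕ) = 1) ∧ v = 2 * n + (C S : ℕ)
  let F : (ℕ → SignType) → ℕ := fun X => Nat.findGreatest (R X) (2 * n + m - 1)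
  have hR0 : ∀ X, R X 0 := fun X => Or.inl ⟨by omega, fun _ => 0, by omega, by omega⟩
  have hRle : ∀ X v, R X v → v ≤ F X := by
    intro X v hv
    refine Nat.le_findGreatest ?_ hv
    rcases hv with hv | ⟨S, -, hv⟩
    · omega
    · have := (C S).2; omega
  have hRF : ∀ X, R X (F X) := fun X => Nat.findGreatest_spec (Nat.zero_le _) (hR0 X)
  have hAlt : ∀ X v, v ≤ 2 * n → HasAlternation (2 * n + k) v X → v ≤ F X := by
    intro X v hv hX
    rcases hv.lt_or_eq with hlt | rfl
    · exact hRle X v (Or.inl ⟨hlt, hX⟩)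
    · obtain ⟨S, hS⟩ := hX.exists_schrijverVertex
      exact (Nat.le_add_right _ _).trans (hRle X _ (Or.inr ⟨S, hS, rfl⟩))
  have hone : ∀ X : ℕ → SignType, ∀ i < 2 * n + k, X i = 1 → 1 ≤ F X := fun X i hi hX =>
    hAlt X 1 (by omega) ⟨fun _ => i, by omega, fun j hj => ⟨hi, by
      obtain rfl : j = 0 := by omega
      simpa using hX⟩⟩
  have key := le_of_forall_ne_neg (N := 2 * n + k) (M := 2 * n + m - 1) F ?_
    (fun X => Nat.findGreatest_le _) ?_
  · omega
  · intro X Y hXY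
    refine hRle Y _ ?_
    rcases hRF X with ⟨h₁, h₂⟩ | ⟨S, hS, h₂⟩
    · exact Or.inl ⟨h₁, h₂.mono hXY⟩
    · exact Or.inr ⟨S, fun i hi => by rw [hXY _ (by rw [hS i hi]; decide), hS i hi], h₂⟩
  · intro X hX hsupp heq
    have hpos : 1 ≤ F X := by
      obtain ⟨i, hi⟩ := Function.ne_iff.1 hX
      have hiN : i < 2 * n + k := by
        by_contra hc; exact hi (hsupp i (by omega))
      rcases SignType.trichotomy (X i) with h | h | h
      · rw [heq]; exact hone (-X) i hiN (by simp [h])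
      · exact absurd h hi
      · exact hone X i hiN h
    have h1 := hRF X
    have h2 := hRF (-X)
    rw [← heq] at h2
    rcases h1 with ⟨hlt, x, hx₁, hx₂⟩ | ⟨S, hS, hv⟩
    · rcases h2 with ⟨-, y, hy₁, hy₂⟩ | ⟨T, -, hv⟩
      · have hx0 := hx₂ 0 hpos
        have hy0 := hy₂ 0 hpos
        rw [pow_zero] at hx0 hy0
        -- The alternation that starts earlier lends its first term to the other one, making a
        -- longer alternation and contradicting maximality.
        rcases lt_trichotomy (x 0) (y 0) with h | h | h
        · have := hAlt X _ (by omega) (hasAlternation_cons h hx0.1 hx0.2 hy₁ hy₂)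
          omega
        · have e1 := hx0.2
          have e2 := hy0.2
          rw [← h, Pi.neg_apply, e1] at e2
          exact absurd e2 (by decide)
        · have := hAlt (-X) _ (by omega)
            (hasAlternation_cons h hy0.1 hy0.2 hx₁ (by simpa using hx₂))
          omega
      · omega
    · rcases h2 with ⟨hlt, -⟩ | ⟨T, hT, hv'⟩
      · omega
      · have hdisj : Disjoint S.1 T.1 := by
          rw [Finset.disjoint_left]
          intro i hi hi'
          have := hT i hi'
          rw [Pi.neg_apply, hS i hi] at this
          exact absurd this (by decide)
        have hne : S ≠ T := by
          rintro rfl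
          have := S.2.1
          rw [(Finset.disjoint_self_iff_empty _).1 hdisj, Finset.card_empty] at this
          omega
        exact C.valid (show (schrijverGraph n k).Adj S T from ⟨hne, hdisj⟩)
          (Fin.ext (by omega))


/-! ### Clique covers, complements and Kőnig's theorem -/

section CliqueCover

variable {V : Type*} {G : SimpleGraph V}

theorem colorable_compl_iff_exists_cliqueCover {m : ℕ} :
    Gᶜ.Colorable m ↔
      ∃ c : Fin m → Set V, (∀ i, G.IsClique (c i)) ∧ ⋃ i, c i = Set.univ := by
  constructor
  · rintro ⟨C⟩
    refine ⟨fun i => {v | C v = i}, fun i v hv w hw hne => ?_, ?_⟩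
    · by_contra h
      exact C.valid ((SimpleGraph.compl_adj G v w).2 ⟨hne, h⟩) (hv.trans hw.symm)
    · ext v; simp
  · rintro ⟨c, hc, hu⟩
    have : ∀ v, ∃ i, v ∈ c i := fun v => Set.mem_iUnion.1 (hu ▸ Set.mem_univ v)
    choose C hC using this
    refine ⟨SimpleGraph.Coloring.mk C fun {v w} hvw heq => ?_⟩
    rw [SimpleGraph.compl_adj] at hvw
    exact hvw.2 (hc (C v) (hC v) (heq ▸ hC w) hvw.1)

theorem cliqueCoverNum_eq_chromaticNumber_compl [Finite V] (G : SimpleGraph V) :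
    cliqueCoverNum G = Gᶜ.chromaticNumber.toNat := by
  rw [SimpleGraph.Colorable.chromaticNumber_eq_sInf
    (SimpleGraph.colorable_chromaticNumber_of_fintype Gᶜ), ENat.toNat_natCast, cliqueCoverNum]
  congr 1
  ext m
  exact colorable_compl_iff_exists_cliqueCover.symm

theorem cliqueCoverNum_le_card {ι : Type*} [Fintype ι] (c : ι → Set V)
    (hc : ∀ i, G.IsClique (c i)) (hu : ∀ v, ∃ i, v ∈ c i) :
    cliqueCoverNum G ≤ Fintype.card ι := by
  refine Nat.sInf_le ⟨c ∘ (Fintype.equivFin ι).symm, fun i => hc _, ?_⟩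
  ext v
  obtain ⟨i, hi⟩ := hu v
  simp only [Set.mem_iUnion, Set.mem_univ, iff_true]
  exact ⟨Fintype.equivFin ι i, by simpa using hi⟩

theorem compl_induce (G : SimpleGraph V) (s : Set V) : (G.induce s)ᶜ = Gᶜ.induce s := by
  ext v w
  simp [SimpleGraph.compl_adj, Subtype.ext_iff]

theorem chiBoundedBy_compl_iff [Finite V] {f : ℕ → ℝ} :
    ChiBoundedBy Gᶜ f ↔ ThetaBoundedBy G f := by
  refine forall_congr' fun s => ?_
  rw [← compl_induce, cliqueCoverNum_eq_chromaticNumber_compl, SimpleGraph.cliqueNum_compl]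

theorem thetaBoundedBy_compl_iff [Finite V] {f : ℕ → ℝ} :
    ThetaBoundedBy Gᶜ f ↔ ChiBoundedBy G f := by
  rw [← chiBoundedBy_compl_iff, compl_compl]

/-- If `I` is a largest independent subset of `A ∪ B`, where `A` is independent, then `A \ I` can be
matched into `I`. -/
theorem exists_matching_into_independent {A B I : Finset V} [DecidableEq V]
    (hA : G.IsIndepSet (A : Set V)) (hI : G.IsIndepSet (I : Set V)) (hIAB : I ⊆ A ∪ B)
    (hmax : ∀ J ⊆ A ∪ B, G.IsIndepSet (J : Set V) → J.card ≤ I.card) :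
    ∃ f : {a // a ∈ A \ I} → V, Function.Injective f ∧ ∀ a, f a ∈ I ∧ G.Adj a (f a) := by
  classical
  have := (Finset.all_card_le_biUnion_card_iff_exists_injective
    (fun a : {a // a ∈ A \ I} => I.filter fun v => G.Adj a v)).1 ?_
  · simpa only [Finset.mem_filter] using this
  intro T
  set N := T.biUnion fun a : {a // a ∈ A \ I} => I.filter fun v => G.Adj a v with hN
  have hT : ∀ v ∈ T.map (Function.Embedding.subtype _), v ∈ A ∧ v ∉ I := by
    intro v hv
    obtain ⟨a, -, rfl⟩ := Finset.mem_map.1 hv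
    exact Finset.mem_sdiff.1 a.2
  have hNI : N ⊆ I := by
    intro v hv
    obtain ⟨a, -, ha⟩ := Finset.mem_biUnion.1 hv
    exact (Finset.mem_filter.1 ha).1
  have hTN : ∀ v ∈ T.map (Function.Embedding.subtype _), ∀ w ∈ I \ N, ¬ G.Adj v w := by
    intro v hv w hw h
    obtain ⟨a, ha, rfl⟩ := Finset.mem_map.1 hv
    rw [Finset.mem_sdiff] at hw
    exact hw.2 (Finset.mem_biUnion.2 ⟨a, ha, Finset.mem_filter.2 ⟨hw.1, h⟩⟩)
  -- Hall's condition by exchange: replacing N, the neighbours of T in I, by T keeps the set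
  -- independent, so |T| ≤ |N|.
  have hcard := hmax (T.map (Function.Embedding.subtype _) ∪ (I \ N)) ?_ ?_
  · rw [Finset.card_union_of_disjoint, Finset.card_map, Finset.card_sdiff_of_subset hNI] at hcard
    · have := Finset.card_le_card hNI
      omega
    · rw [Finset.disjoint_left]
      exact fun v hv hv' => (hT v hv).2 (Finset.mem_sdiff.1 hv').1
  · intro v hv
    rcases Finset.mem_union.1 hv with hv | hv
    · exact Finset.mem_union_left _ (hT v hv).1
    · exact hIAB (Finset.mem_sdiff.1 hv).1
  · intro v hv w hw hne
    rcases Finset.mem_union.1 hv with hv | hv <;> rcases Finset.mem_union.1 hw with hw | hw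
    · exact hA (hT v hv).1 (hT w hw).1 hne
    · exact hTN v hv w hw
    · exact fun h => hTN w hw v hv h.symm
    · exact hI (Finset.mem_sdiff.1 hv).1 (Finset.mem_sdiff.1 hw).1 hne

/-- A form of **Kőnig's theorem**: if `A` and `B` are independent, then the clique cover number is
at most the independence number plus the number of vertices outside `A ∪ B`. -/
theorem cliqueCoverNum_le_indepNum_add_card [Fintype V] [DecidableEq V] {A B : Finset V}
    (hA : G.IsIndepSet (A : Set V)) (hB : G.IsIndepSet (B : Set V)) :
    cliqueCoverNum G ≤ G.indepNum + (A ∪ B)ᶜ.card := by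
  classical
  obtain ⟨I, hI, hmax⟩ := ((A ∪ B).powerset.filter
    fun J : Finset V => G.IsIndepSet (J : Set V)).exists_max_image Finset.card ⟨∅, by simp⟩
  simp only [Finset.mem_filter, Finset.mem_powerset] at hI hmax
  obtain ⟨hIAB, hI⟩ := hI
  obtain ⟨f, hf, hfI⟩ := exists_matching_into_independent hA hI hIAB fun J h h' => hmax J ⟨h, h'⟩
  obtain ⟨g, hg, hgI⟩ := exists_matching_into_independent hB hI (Finset.union_comm A B ▸ hIAB)
    fun J h h' => hmax J ⟨Finset.union_comm A B ▸ h, h'⟩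
  have hAB : ∀ v ∈ I, ∀ a b, f a = v → g b = v → False := by
    intro v hv a b ha hb
    have h1 := hfI a
    have h2 := hgI b
    rw [ha] at h1
    rw [hb] at h2
    rcases Finset.mem_union.1 (hIAB hv) with h | h
    · exact hA (Finset.mem_sdiff.1 a.2).1 h h1.2.ne h1.2
    · exact hB (Finset.mem_sdiff.1 b.2).1 h h2.2.ne h2.2
  -- Each v in I is matched at most once, since `hAB` keeps the two matchings apart; so its class is
  -- a vertex or an edge.
  let c : {v // v ∈ I} ⊕ {v // v ∈ (A ∪ B)ᶜ} → Set V := Sum.elim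
    (fun v => {w | w = v ∨ (∃ h, f ⟨w, h⟩ = v) ∨ ∃ h, g ⟨w, h⟩ = v}) (fun v => {v.1})
  have key := cliqueCoverNum_le_card (G := G) c ?_ ?_
  · rw [Fintype.card_sum, Fintype.card_coe, Fintype.card_coe] at key
    exact key.trans (Nat.add_le_add_right hI.card_le_indepNum _)
  · rintro (v | v)
    · rintro x hx y hy hne
      rcases hx with rfl | ⟨hx, hx'⟩ | ⟨hx, hx'⟩ <;> rcases hy with rfl | ⟨hy, hy'⟩ | ⟨hy, hy'⟩
      · exact absurd rfl hne
      · exact hy' ▸ (hfI ⟨y, hy⟩).2.symm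
      · exact hy' ▸ (hgI ⟨y, hy⟩).2.symm
      · exact hx' ▸ (hfI ⟨x, hx⟩).2
      · exact absurd (congrArg Subtype.val (hf (hx'.trans hy'.symm))) hne
      · exact (hAB v v.2 _ _ hx' hy').elim
      · exact hx' ▸ (hgI ⟨x, hx⟩).2
      · exact (hAB v v.2 _ _ hy' hx').elim
      · exact absurd (congrArg Subtype.val (hg (hx'.trans hy'.symm))) hne
    · exact SimpleGraph.IsClique.of_subsingleton Set.subsingleton_singleton
  · intro v
    by_cases hv : v ∈ A ∪ B
    · by_cases hvI : v ∈ I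
      · exact ⟨Sum.inl ⟨v, hvI⟩, Or.inl rfl⟩
      · rcases Finset.mem_union.1 hv with h | h
        · have h' : v ∈ A \ I := Finset.mem_sdiff.2 ⟨h, hvI⟩
          exact ⟨Sum.inl ⟨f ⟨v, h'⟩, (hfI _).1⟩, Or.inr (Or.inl ⟨h', rfl⟩)⟩
        · have h' : v ∈ B \ I := Finset.mem_sdiff.2 ⟨h, hvI⟩
          exact ⟨Sum.inl ⟨g ⟨v, h'⟩, (hgI _).1⟩, Or.inr (Or.inr ⟨h', rfl⟩)⟩
    · exact ⟨Sum.inr ⟨v, Finset.mem_compl.2 hv⟩, rfl⟩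

end CliqueCover


/-! ### Counting in Schrijver graphs -/

section Schrijver

variable {n k : ℕ}

theorem isIndepSet_schrijverVertex_mem (s : Set (SchrijverVertex n k)) (p : Fin (2 * n + k))
    (A : Finset s) (hA : ∀ S ∈ A, p ∈ S.1.1) :
    ((schrijverGraph n k).induce s).IsIndepSet (A : Set s) := by
  intro S hS T hT _ h
  exact Finset.disjoint_left.1 h.2 (hA S hS) (hA T hT)

theorem cliqueNum_schrijverGraph_le_two (h : k < n) : (schrijverGraph n k).cliqueNum ≤ 2 := by
  classical
  obtain ⟨s, hs, hcard⟩ := (schrijverGraph n k).exists_isNClique_cliqueNum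
  rw [← hcard]
  have h1 : (s.biUnion fun S => S.1).card = s.card * n := by
    rw [Finset.card_biUnion fun S hS T hT hne => (hs hS hT hne).2, Finset.sum_const_nat]
    exact fun S _ => S.2.1
  have h2 := Finset.card_le_univ (s.biUnion fun S => S.1)
  rw [h1, Fintype.card_fin] at h2
  by_contra! h3
  have := Nat.mul_le_mul_right n h3
  omega

variable [NeZero (2 * n + k)]

theorem cycleGraph_adj_add_one {N : ℕ} [NeZero N] (hN : 2 ≤ N) (p : Fin N) :
    (SimpleGraph.cycleGraph N).Adj p (p + 1) := by
  obtain ⟨m, rfl⟩ : ∃ m, N = m + 2 := ⟨N - 2, by omega⟩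
  rw [SimpleGraph.cycleGraph_adj]
  right
  abel

/-- The positions `p` such that `S` contains neither `p` nor its successor. -/
def missedPairs (S : SchrijverVertex n k) : Finset (Fin (2 * n + k)) :=
  Finset.univ.filter fun p => p ∉ S.1 ∧ p + 1 ∉ S.1

/-- S and its shift by −1 are disjoint `n`-sets, as S contains no two neighbours; the missed
positions are the rest. -/
theorem card_missedPairs (hn : 1 ≤ n) (S : SchrijverVertex n k) : (missedPairs S).card = k := by
  classical
  have h1 : (Finset.univ.filter fun p => p + 1 ∈ S.1).card = n := by
    refine Eq.trans ?_ S.2.1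
    refine Finset.card_bij (fun p _ => p + 1) (fun p hp => (Finset.mem_filter.1 hp).2)
      (fun p _ q _ h => add_right_cancel h) fun p hp => ⟨p - 1, ?_, by simp⟩
    simpa using hp
  have h2 : Disjoint S.1 (Finset.univ.filter fun p => p + 1 ∈ S.1) := by
    rw [Finset.disjoint_left]
    intro p hp hp'
    have hadj := cycleGraph_adj_add_one (by omega) p
    exact S.2.2 hp (Finset.mem_filter.1 hp').2 hadj.ne hadj
  have h3 : missedPairs S = (S.1 ∪ Finset.univ.filter fun p => p + 1 ∈ S.1)ᶜ := by
    ext p; simp [missedPairs]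
  rw [h3, Finset.card_compl, Finset.card_union_of_disjoint h2, h1, S.2.1, Fintype.card_fin]
  omega

/-- Going round the cycle, membership of p+1 is determined by membership of p and by whether p is
missed. -/
theorem eq_of_missedPairs_eq (hn : 1 ≤ n) {S T : SchrijverVertex n k}
    (h : missedPairs S = missedPairs T) (h0 : 0 ∈ S.1 ↔ 0 ∈ T.1) : S = T := by
  have step : ∀ (S : SchrijverVertex n k) (p : Fin (2 * n + k)),
      p + 1 ∈ S.1 ↔ p ∉ S.1 ∧ p ∉ missedPairs S := by
    intro S p
    have hadj := cycleGraph_adj_add_one (by omega) p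
    have : p ∈ S.1 → p + 1 ∈ S.1 → False := fun h h' => S.2.2 h h' hadj.ne hadj
    simp only [missedPairs, Finset.mem_filter, Finset.mem_univ, true_and]
    tauto
  have key : ∀ i : ℕ, (Fin.ofNat (2 * n + k) i) ∈ S.1 ↔ (Fin.ofNat (2 * n + k) i) ∈ T.1 := by
    intro i
    induction i with
    | zero => exact h0
    | succ i ih =>
      have : Fin.ofNat (2 * n + k) (i + 1) = Fin.ofNat (2 * n + k) i + 1 := by
        ext; simp [Fin.val_add]
      rw [this, step, step, ih, h]
  refine Subtype.ext (Finset.ext fun p => ?_)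
  simpa using key p

theorem card_schrijverVertex_le (hn : 1 ≤ n) :
    Nat.card (SchrijverVertex n k) ≤ 2 * (2 * n + k) ^ k := by
  classical
  let f : SchrijverVertex n k → {s // s ∈ Finset.powersetCard k
      (Finset.univ : Finset (Fin (2 * n + k)))} × Bool := fun S =>
    (⟨missedPairs S, Finset.mem_powersetCard.2 ⟨Finset.subset_univ _, card_missedPairs hn S⟩⟩,
      decide (0 ∈ S.1))
  have hf : Function.Injective f := by
    intro S T h
    have h1 := congrArg (fun x => x.1.1) h
    have h2 := congrArg Prod.snd h
    exact eq_of_missedPairs_eq hn h1 (decide_eq_decide.1 h2)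
  rw [Nat.card_eq_fintype_card]
  refine (Fintype.card_le_of_injective f hf).trans ?_
  rw [Fintype.card_prod, Fintype.card_coe, Finset.card_powersetCard, Finset.card_univ,
    Fintype.card_fin, Fintype.card_bool, mul_comm]
  exact Nat.mul_le_mul_left _ (Nat.choose_le_pow _ _)

theorem mul_cliqueCoverNum_induce_schrijverGraph_le (hn : 1 ≤ n)
    (s : Set (SchrijverVertex n k)) :
    n * cliqueCoverNum ((schrijverGraph n k).induce s) ≤
      (n + k) * ((schrijverGraph n k).induce s).indepNum := by
  classical
  set H := (schrijverGraph n k).induce s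
  let A : Fin (2 * n + k) → Finset s := fun p => Finset.univ.filter fun S => p ∈ S.1.1
  have hA : ∀ p, H.IsIndepSet (A p : Set s) := fun p =>
    isIndepSet_schrijverVertex_mem s p (A p) fun S hS => (Finset.mem_filter.1 hS).2
  let D : Fin (2 * n + k) → Finset s := fun p => Finset.univ.filter fun S => p ∈ missedPairs S.1
  have hD : ∀ p, (A p ∪ A (p + 1))ᶜ = D p := by
    intro p; ext S; simp [A, D, missedPairs]
  have hsumA : ∑ p, (A p).card = Fintype.card s * n := by
    have := Finset.sum_card_bipartiteAbove_eq_sum_card_bipartiteBelow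
      (s := (Finset.univ : Finset (Fin (2 * n + k)))) (t := (Finset.univ : Finset s))
      (fun p S => p ∈ S.1.1)
    simp only [Finset.bipartiteAbove, Finset.bipartiteBelow] at this
    rw [this, Finset.sum_const_nat (m := n), Finset.card_univ]
    intro S _
    simp [S.1.2.1]
  have hsumD : ∑ p, (D p).card = Fintype.card s * k := by
    have := Finset.sum_card_bipartiteAbove_eq_sum_card_bipartiteBelow
      (s := (Finset.univ : Finset (Fin (2 * n + k)))) (t := (Finset.univ : Finset s))
      (fun p S => p ∈ missedPairs S.1)
    simp only [Finset.bipartiteAbove, Finset.bipartiteBelow] at this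
    rw [this, Finset.sum_const_nat (m := k), Finset.card_univ]
    intro S _
    simp [card_missedPairs hn S.1]
  have hα : Fintype.card s * n ≤ (2 * n + k) * H.indepNum := by
    rw [← hsumA]
    refine (Finset.sum_le_card_nsmul _ _ H.indepNum fun p _ => (hA p).card_le_indepNum).trans ?_
    simp
  -- Averaging: some p has at most the mean number of vertices missing both p and p+1.
  obtain ⟨p, -, hp⟩ := Finset.exists_le_of_sum_le
    (s := (Finset.univ : Finset (Fin (2 * n + k)))) (f := fun p => (2 * n + k) * (D p).card)
    (g := fun _ => Fintype.card s * k) ⟨0, Finset.mem_univ _⟩ (by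
      rw [← Finset.mul_sum, hsumD]; simp)
  have hθ := cliqueCoverNum_le_indepNum_add_card (hA p) (hA (p + 1))
  rw [hD] at hθ
  have hDα : n * (D p).card ≤ k * H.indepNum := by
    refine Nat.le_of_mul_le_mul_left ?_ (show 0 < 2 * n + k by omega)
    calc (2 * n + k) * (n * (D p).card) = n * ((2 * n + k) * (D p).card) := by ring
      _ ≤ n * (Fintype.card s * k) := Nat.mul_le_mul_left _ hp
      _ = k * (Fintype.card s * n) := by ring
      _ ≤ k * ((2 * n + k) * H.indepNum) := Nat.mul_le_mul_left _ hα
      _ = (2 * n + k) * (k * H.indepNum) := by ring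
  calc n * cliqueCoverNum H ≤ n * (H.indepNum + (D p).card) := Nat.mul_le_mul_left _ hθ
    _ ≤ (n + k) * H.indepNum := by linarith

end Schrijver

/-! ### Choosing n large for fixed k -/

open Filter Asymptotics

theorem eventually_mul_rpow_le (j c : ℝ) (hc : 0 ≤ c) {K : ℕ} :
    ∀ᶠ n : ℕ in atTop, ∀ x : ℝ, 2 ≤ x → x ≤ (n : ℝ) ^ K → c * Real.log x ^ j ≤ n := by
  -- The sum of the two endpoint values bounds (log x)^j for either sign of j.
  have h1 : (fun x : ℝ => c * (Real.log 2 ^ j + (K : ℝ) ^ j * Real.log x ^ j)) =o[atTop]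
      fun x : ℝ => x := by
    refine IsLittleO.const_mul_left (IsLittleO.add ?_ (IsLittleO.const_mul_left ?_ _)) _
    · exact isLittleO_const_id_atTop _
    · simpa using isLittleO_log_rpow_rpow_atTop j one_pos
  have h2 := (h1.bound one_pos).natCast_atTop
  filter_upwards [h2, eventually_ge_atTop 1] with n hn hn1 x hx hxn
  have hn0 : (0 : ℝ) ≤ n := Nat.cast_nonneg n
  have hlog2 : 0 < Real.log 2 := Real.log_pos one_lt_two
  have hlogn : 0 ≤ Real.log n := Real.log_natCast_nonneg n
  have hx2 : Real.log 2 ≤ Real.log x := Real.log_le_log two_pos hx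
  have hxn' : Real.log x ≤ K * Real.log n := by
    rw [← Real.log_pow]; exact Real.log_le_log (by linarith) hxn
  rw [one_mul, Real.norm_of_nonneg hn0] at hn
  refine le_trans (mul_le_mul_of_nonneg_left ?_ hc) ((le_abs_self _).trans hn)
  rw [← Real.mul_rpow (Nat.cast_nonneg K) hlogn]
  have h3 : 0 ≤ Real.log 2 ^ j := Real.rpow_nonneg hlog2.le _
  have h4 : 0 ≤ (K * Real.log n) ^ j := Real.rpow_nonneg (by positivity) _
  rcases le_total 0 j with hj | hj
  · linarith [Real.rpow_le_rpow (hlog2.le.trans hx2) hxn' hj]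
  · linarith [Real.rpow_le_rpow_of_nonpos hlog2 hx2 hj]

theorem thetaBoundedBy_schrijverGraph {n k : ℕ} (hn : 1 ≤ n) (j : ℝ)
    (h : ∀ x : ℝ, 2 ≤ x → x ≤ 2 * ((2 * n + k : ℕ) : ℝ) ^ k → k * Real.log x ^ j ≤ n) :
    ThetaBoundedBy (schrijverGraph n k) (polylogFun j) := by
  classical
  have : NeZero (2 * n + k) := ⟨by omega⟩
  intro s
  have hle := mul_cliqueCoverNum_induce_schrijverGraph_le (k := k) hn s
  set H := (schrijverGraph n k).induce s
  obtain ⟨I, hI⟩ := H.exists_isNIndepSet_indepNum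
  have hα : H.indepNum ≤ 2 * (2 * n + k) ^ k := by
    rw [← hI.2]
    refine le_trans ?_ (card_schrijverVertex_le (n := n) (k := k) hn)
    rw [Nat.card_eq_fintype_card]
    exact (Finset.card_le_univ I).trans (Fintype.card_subtype_le _)
  have hn' : (0 : ℝ) < n := by exact_mod_cast hn
  have hlogα : 0 ≤ Real.log (H.indepNum : ℝ) := Real.log_natCast_nonneg _
  rcases Nat.lt_or_ge H.indepNum 2 with hlt | hge
  -- For α ≤ 1 the logarithm is useless, but H is complete, so θ ≤ α already holds.
  · have hbase : (cliqueCoverNum H : ℝ) ≤ H.indepNum := by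
      have : ∀ v w, v ≠ w → H.Adj v w := by
        intro v w hvw
        by_contra hadj
        have hi : H.IsIndepSet (({v, w} : Finset s) : Set s) := by
          intro a ha b hb hab h
          simp only [Finset.coe_insert, Finset.coe_singleton, Set.mem_insert_iff,
            Set.mem_singleton_iff] at ha hb
          rcases ha with rfl | rfl <;> rcases hb with rfl | rfl
          · exact hab rfl
          · exact hadj h
          · exact hadj h.symm
          · exact hab rfl
        have := hi.card_le_indepNum
        rw [Finset.card_pair hvw] at this
        omega
      rcases Nat.eq_zero_or_pos H.indepNum with h0 | h0
      · have : n * cliqueCoverNum H ≤ 0 := by simpa [h0] using hle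
        have : cliqueCoverNum H = 0 := by
          rcases Nat.mul_eq_zero.1 (Nat.le_zero.1 this) with h | h
          · omega
          · exact h
        simp [this]
      · have := cliqueCoverNum_le_card (G := H) (fun _ : Unit => Set.univ)
          (fun _ v _ w _ hvw => this v w hvw) (fun v => ⟨(), trivial⟩)
        exact_mod_cast this.trans (by rw [Fintype.card_unit]; exact h0)
    have : 0 ≤ (H.indepNum : ℝ) / Real.log H.indepNum ^ j :=
      div_nonneg (Nat.cast_nonneg _) (Real.rpow_nonneg hlogα _)
    unfold polylogFun
    linarith
  · have hx := h H.indepNum (by exact_mod_cast hge) (by exact_mod_cast hα)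
    have hlogpos : 0 < Real.log (H.indepNum : ℝ) := Real.log_pos (by exact_mod_cast hge)
    have hL : 0 < Real.log (H.indepNum : ℝ) ^ j := Real.rpow_pos_of_pos hlogpos _
    have hle' : (n : ℝ) * cliqueCoverNum H ≤ (n + k) * H.indepNum := by exact_mod_cast hle
    have hα0 : (0 : ℝ) ≤ H.indepNum := Nat.cast_nonneg _
    have hk : (k : ℝ) / n ≤ 1 / Real.log (H.indepNum : ℝ) ^ j := by
      rw [div_le_div_iff₀ hn' hL]; linarith
    calc (cliqueCoverNum H : ℝ) ≤ (n + k) * H.indepNum / n := by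
          rw [le_div_iff₀ hn']; linarith
      _ = H.indepNum + H.indepNum * (k / n) := by field_simp
      _ ≤ H.indepNum + H.indepNum * (1 / Real.log (H.indepNum : ℝ) ^ j) := by gcongr
      _ = polylogFun j H.indepNum := by unfold polylogFun; ring

theorem exists_thetaBoundedBy_schrijverGraph (j : ℝ) (k : ℕ) :
    ∃ n, k < n ∧ ThetaBoundedBy (schrijverGraph n k) (polylogFun j) := by
  obtain ⟨n, hn, hnk⟩ := ((eventually_mul_rpow_le j k (Nat.cast_nonneg k) (K := 2 * k + 1)).and
    (eventually_ge_atTop (k + 3))).exists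
  refine ⟨n, by omega, thetaBoundedBy_schrijverGraph (by omega) j fun x hx hx' =>
    hn x hx (hx'.trans ?_)⟩
  have h : 2 * (2 * n + k) ^ k ≤ n ^ (2 * k + 1) :=
    calc 2 * (2 * n + k) ^ k ≤ n * (n ^ 2) ^ k := by
          refine Nat.mul_le_mul (by omega) (Nat.pow_le_pow_left ?_ k)
          nlinarith
      _ = n ^ (2 * k + 1) := by ring
  exact_mod_cast h

end ChiBoundedness

open ChiBoundedness

theorem theorem4p8 (j : ℝ) :
    ¬ ComplementaryBounded (polylogFun j) ∧
    ∃ S : Set (ℕ × ℕ),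
      (∀ p ∈ S, ThetaBoundedBy (schrijverGraph p.1 p.2) (polylogFun j)) ∧
      (∀ p ∈ S, ChiBoundedBy (schrijverGraph p.1 p.2)ᶜ (polylogFun j)) ∧
      (∀ m : ℕ, ∃ p ∈ S, (m : ℕ∞) ≤ (schrijverGraph p.1 p.2).chromaticNumber) ∧
      (¬ ∃ g : ℕ → ℝ, ∀ p ∈ S, ChiBoundedBy (schrijverGraph p.1 p.2) g) ∧
      (¬ ∃ g : ℕ → ℝ, ∀ p ∈ S, ThetaBoundedBy (schrijverGraph p.1 p.2)ᶜ g) := by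
  set S : Set (ℕ × ℕ) :=
    {p | p.2 < p.1 ∧ ThetaBoundedBy (schrijverGraph p.1 p.2) (polylogFun j)} with hS
  have hunb : ∀ m : ℕ, ∃ p ∈ S, (m : ℕ∞) ≤ (schrijverGraph p.1 p.2).chromaticNumber := by
    intro m
    obtain ⟨n, hn, hθ⟩ := exists_thetaBoundedBy_schrijverGraph j m
    refine ⟨(n, m), ⟨hn, hθ⟩, SimpleGraph.le_chromaticNumber_iff_colorable.2 fun l hl => ?_⟩
    exact (lt_of_schrijverGraph_colorable (by omega) hl).le
  have hchi : ¬ ∃ g : ℕ → ℝ, ∀ p ∈ S, ChiBoundedBy (schrijverGraph p.1 p.2) g := by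
    rintro ⟨g, hg⟩
    -- The clique numbers involved are at most 2, so only these three values of g matter.
    obtain ⟨m, hm⟩ := exists_nat_gt (max (g 0) (max (g 1) (g 2)))
    obtain ⟨p, hp, hmp⟩ := hunb m
    have h1 := hg p hp Set.univ
    have e := SimpleGraph.induceUnivIso (schrijverGraph p.1 p.2)
    have hω : ((schrijverGraph p.1 p.2).induce Set.univ).cliqueNum ≤ 2 :=
      (SimpleGraph.cliqueNum_induce_le _).trans (cliqueNum_schrijverGraph_le_two hp.1)
    have h2 : m ≤ ((schrijverGraph p.1 p.2).induce Set.univ).chromaticNumber.toNat := by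
      have h3 := hmp.trans (SimpleGraph.chromaticNumber_mono_of_hom e.symm.toHom)
      have h4 := SimpleGraph.chromaticNumber_ne_top_iff_exists.2
        ⟨_, SimpleGraph.colorable_chromaticNumber_of_fintype
          ((schrijverGraph p.1 p.2).induce Set.univ)⟩
      rw [← ENat.natCast_toNat h4] at h3
      exact_mod_cast h3
    have h5 : (m : ℝ) ≤ g ((schrijverGraph p.1 p.2).induce Set.univ).cliqueNum :=
      le_trans (by exact_mod_cast h2) h1
    simp only [max_lt_iff] at hm
    generalize ((schrijverGraph p.1 p.2).induce Set.univ).cliqueNum = ω at hω h5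
    interval_cases ω <;> linarith
  have htheta : ¬ ∃ g : ℕ → ℝ, ∀ p ∈ S, ThetaBoundedBy (schrijverGraph p.1 p.2)ᶜ g := by
    rintro ⟨g, hg⟩
    exact hchi ⟨g, fun p hp => thetaBoundedBy_compl_iff.1 (hg p hp)⟩
  have hbdd : ∀ p ∈ S, ChiBoundedBy (schrijverGraph p.1 p.2)ᶜ (polylogFun j) :=
    fun p hp => chiBoundedBy_compl_iff.2 hp.2
  refine ⟨?_, S, fun p hp => hp.2, hbdd, hunb, hchi, htheta⟩
  rintro ⟨g, hg⟩
  exact htheta ⟨g, fun p hp => hg _ _ (hbdd p hp)⟩
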